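/- Let $K(k)=\frac{\pi}{2}\,{}_2F_1\left(\frac12,\frac12;1;k^2\right)$ for $0\le k<1$ be the complete elliptic integral of the first kind, let $P_m(z)={}_2F_1\left(-m,m+1;1;\frac{1-z}{2}\right)$ be the Legendre polynomials, and let $(a)_n=\prod_{i=1}^n(a+i-1)$. There is a neighborhood $U$ of $1$ in $\mathbb R$ such that for all $x,y\in U$ the series below converges absolutely and $$\frac{\pi^2}{2}\sum_{n=0}^\infty\frac{\left(\frac12\right)_n^2}{(n!)^2}\,P_{2n}\!\left(\frac{(x+y)(1-xy)}{(x-y)(1+xy)}\right)\left(\frac{x-y}{1+xy}\right)^{2n}$$ $$=\begin{cases} \dfrac{\pi^2}{2} & \text{if } x=y=1,\\[2mm] \dfrac{1+xy}{xy}\,K\!\left(\dfrac{\sqrt{x^2-1}}{x}\right)K\!\left(\dfrac{\sqrt{y^2-1}}{y}\right) & \text{if } x,y\ge 1,\\[2mm] \dfrac{1+xy}{x}\,K\!\left(\dfrac{\sqrt{x^2-1}}{x}\right)K\!\left(\sqrt{1-y^2}\right) & \text{if } x\ge 1 \text{ and } y\le 1,\\[2mm] \dfrac{1+xy}{y}\,K\!\left(\sqrt{1-x^2}\right)K\!\left(\dfrac{\sqrt{y^2-1}}{y}\right)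 & \text{if } x\le 1 \text{ and } y\ge 1,\\[2mm] (1+xy)\,K\!\left(\sqrt{1-x^2}\right)K\!\left(\sqrt{1-y^2}\right) & \text{if } x,y\le 1. \end{cases}$$ The cases overlap, and each formula holds whenever its condition does. On the diagonal $x=y$, where the argument of $P_{2n}$ is undefined, the factor $P_{2n}(\cdots)\left(\frac{x-y}{1+xy}\right)^{2n}$ in each term is understood as its limit from points $(x',y')$ with $x'\ne y'$ tending to $(x,y)$; these limits exist. -/

import Mathlib

open Filter Topology

/-- The Legendre polynomial `P_m(z) = ₂F₁(-m, m+1; 1; (1-z)/2)`; the series terminates. -/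
noncomputable def legendreP (m : ℕ) (z : ℝ) : ℝ :=
  ordinaryHypergeometric (-(m : ℝ)) ((m : ℝ) + 1) (1 : ℝ) ((1 - z) / 2)

/-- The complete elliptic integral of the first kind as a function of the modulus `k ∈ [0,1)`,
`K(k) = (π/2) ₂F₁(1/2, 1/2; 1; k²)`. -/
noncomputable def ellipticK (k : ℝ) : ℝ :=
  Real.pi / 2 * ordinaryHypergeometric (1 / 2 : ℝ) (1 / 2 : ℝ) (1 : ℝ) (k ^ 2)

/-- The coefficient `(1/2)_n² / (n!)²`. -/
noncomputable def wzCoeff (n : ℕ) : ℝ :=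
  ((ascPochhammer ℝ n).eval (1 / 2 : ℝ)) ^ 2 / (n.factorial : ℝ) ^ 2

/-- The expression
`P_{2n}((x+y)(1-xy) / ((x-y)(1+xy))) * ((x-y)/(1+xy))^{2n}`, meaningful for
`x ≠ y` and `1 + xy ≠ 0`. -/
noncomputable def wzFactor (n : ℕ) (x y : ℝ) : ℝ :=
  legendreP (2 * n) (((x + y) * (1 - x * y)) / ((x - y) * (1 + x * y)))
    * ((x - y) / (1 + x * y)) ^ (2 * n)

/-- `t` is the value at `(x, y)` of the `n`-th Legendre factor: the expression itself if `x ≠ y`,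
and on the diagonal, where the singularity is removable, its limit from off the diagonal. -/
def IsWZFactor (n : ℕ) (x y t : ℝ) : Prop :=
  (x ≠ y → t = wzFactor n x y) ∧
  (x = y → Tendsto (fun q : ℝ × ℝ => wzFactor n q.1 q.2)
    (𝓝[{q : ℝ × ℝ | q.1 ≠ q.2}] (x, y)) (𝓝 t))

/-- The Legendre series at `(x, y)` converges (absolutely) and, multiplied by `π²/2`, equals `v`. -/
def WZSeriesEq (x y v : ℝ) : Prop :=
  ∃ t : ℕ → ℝ, (∀ n, IsWZFactor n x y (t n)) ∧
    Summable (fun n => wzCoeff n * t n) ∧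
    Real.pi ^ 2 / 2 * ∑' n, wzCoeff n * t n = v

/-! Put E(x) = ₂F₁(1/2, 1/2; 1; 1 - x²) (`ellipticSeries`), let c_n = `wzCoeff n`, and let Q_m be
the Legendre factor. All cases reduce to Σ c_n Q_{2n}(x,y) = (1 + xy) E(x) E(y) / 2
(`tsum_wzCoeff_mul_wzQ`).

For fixed y, both H(x,y) = Σ c_n Q_{2n} / (1 + xy) and E(x) solve (x(1 - x²)F')' = xF and are
regular at the singular point x = 1, so they are proportional: H(x,y) = E(x) H(1,y). Symmetry and
H(1,1) = 1/2 finish. The individual terms satisfy the equation only up to a difference in n, which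
telescopes because c_{n+1}(2n+2)² = c_n(2n+1)² (`sum_wzCoeff_telescope`). Infinite series are never
differentiated: partial sums solve the equation with an error of order N²/4^N, and a Wronskian
estimate (`abs_div_sub_div_le_of_approx_solutions`) passes to the limit.

The arguments ≥ 1 need E(1/x) = x E(x), which follows from the identity at y = 1 and the invariance
of Q_{2n} under (x,y) ↦ (1/x,1/y). -/

/-! ### Homogenized Legendre polynomials -/

/-- The homogenized Legendre polynomials: `homLegendre a (v ^ 2) m = v ^ m * P_m (a / v)`. -/
noncomputable def homLegendre (a b : ℝ) : ℕ → ℝ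
  | 0 => 1
  | 1 => a
  | m + 2 => ((2 * m + 3) * a * homLegendre a b (m + 1) - (m + 1) * b * homLegendre a b m) / (m + 2)

theorem homLegendre_recurrence (a b : ℝ) (m : ℕ) :
    ((m : ℝ) + 1) * homLegendre a b (m + 1) =
      (2 * m + 1) * a * homLegendre a b m - m * b * homLegendre a b (m - 1) := by
  cases m with
  | zero => simp [homLegendre]
  | succ m =>
    have h : (m : ℝ) + 2 ≠ 0 := by positivity
    rw [homLegendre]
    push_cast
    field_simp
    ring_nf

/-- After division by m + 2 the recurrence coefficients are at most 2 and 1, so 2|a|r + |b| ≤ r²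
closes the induction. -/
theorem abs_homLegendre_le {a b r : ℝ} (hr : 0 ≤ r) (ha : |a| ≤ r)
    (hab : 2 * |a| * r + |b| ≤ r ^ 2) (m : ℕ) : |homLegendre a b m| ≤ r ^ m := by
  induction m using Nat.strong_induction_on with
  | _ m ih =>
    match m with
    | 0 => simp [homLegendre]
    | 1 => simpa [homLegendre] using ha
    | m + 2 =>
      have h1 := ih (m + 1) (by omega)
      have h0 := ih m (by omega)
      have hm : (0 : ℝ) < m + 2 := by positivity
      rw [homLegendre, abs_div, abs_of_pos hm, div_le_iff₀ hm]
      calc _ ≤ |(2 * m + 3) * a * homLegendre a b (m + 1)| + |(m + 1) * b * homLegendre a b m| :=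
            abs_sub _ _
        _ = (2 * m + 3) * |a| * |homLegendre a b (m + 1)| + (m + 1) * |b| * |homLegendre a b m| := by
            simp only [abs_mul]
            rw [abs_of_nonneg (by positivity : (0 : ℝ) ≤ 2 * m + 3),
              abs_of_nonneg (by positivity : (0 : ℝ) ≤ m + 1)]
        _ ≤ (2 * (m + 2)) * |a| * r ^ (m + 1) + (m + 2) * |b| * r ^ m := by
            gcongr <;> linarith
        _ = (m + 2) * r ^ m * (2 * |a| * r + |b|) := by ring
        _ ≤ (m + 2) * r ^ m * r ^ 2 := by gcongr
        _ = r ^ (m + 2) * (m + 2) := by ring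

theorem homLegendre_zero_zero (m : ℕ) : homLegendre 0 0 (m + 1) = 0 := by
  have h := abs_homLegendre_le (a := 0) (b := 0) le_rfl (by simp) (by simp) (m + 1)
  simpa using h

theorem homLegendre_neg (a b : ℝ) (m : ℕ) :
    homLegendre (-a) b m = (-1) ^ m * homLegendre a b m := by
  induction m using Nat.strong_induction_on with
  | _ m ih =>
    match m with
    | 0 => simp [homLegendre]
    | 1 => simp [homLegendre]
    | m + 2 =>
      rw [homLegendre, homLegendre, ih (m + 1) (by omega), ih m (by omega)]
      ring

theorem continuous_homLegendre (m : ℕ) :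
    Continuous fun q : ℝ × ℝ => homLegendre q.1 q.2 m := by
  induction m using Nat.strong_induction_on with
  | _ m ih =>
    match m with
    | 0 => simpa [homLegendre] using continuous_const
    | 1 => simpa [homLegendre] using continuous_fst
    | m + 2 =>
      have h1 := ih (m + 1) (by omega)
      have h0 := ih m (by omega)
      simp only [homLegendre]
      fun_prop

/-! ### Three-term recurrence from the hypergeometric form -/

/-- The `k`-th coefficient of `₂F₁(-s, s+1; 1; ·)`. -/
noncomputable def legendreCoeff (s : ℝ) (k : ℕ) : ℝ :=
  (ascPochhammer ℝ k).eval (-s) * (ascPochhammer ℝ k).eval (s + 1) / (k.factorial : ℝ) ^ 2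

theorem ascPochhammer_eval_succ_left (k : ℕ) (s : ℝ) :
    (ascPochhammer ℝ (k + 1)).eval s = s * (ascPochhammer ℝ k).eval (s + 1) := by
  simp [ascPochhammer_succ_left, Polynomial.eval_comp]

theorem legendreCoeff_zero (s : ℝ) : legendreCoeff s 0 = 1 := by simp [legendreCoeff]

/-- This compares coefficients of t^(k+1) in the Legendre recurrence with z = 1 - 2t. -/
theorem legendreCoeff_recurrence (s : ℝ) (k : ℕ) :
    (s + 2) * legendreCoeff (s + 2) (k + 1) = (2 * s + 3) * legendreCoeff (s + 1) (k + 1)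
      - 2 * (2 * s + 3) * legendreCoeff (s + 1) k - (s + 1) * legendreCoeff s (k + 1) := by
  have hf : (k.factorial : ℝ) ≠ 0 := by positivity
  have hk : (k : ℝ) + 1 ≠ 0 := by positivity
  simp only [legendreCoeff, Nat.factorial_succ]
  push_cast
  cases k with
  | zero => simp; ring
  | succ k =>
    -- Shifting the Pochhammer symbols brings out the common factor (-s)_k (s+3)_k; a rational
    -- identity remains.
    have e1 : -(s + 2) + 1 + 1 = -s := by ring
    have e2 : -(s + 1) + 1 = -s := by ring
    have e3 : s + 2 + 1 = s + 3 := by ring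
    have e4 : s + 1 + 1 + 1 = s + 3 := by ring
    have e5 : s + 1 + 1 = s + 2 := by ring
    rw [ascPochhammer_eval_succ_left (k + 1) (-(s + 2)), ascPochhammer_eval_succ_left k, e1, e3,
      ascPochhammer_eval_succ_left (k + 1) (-(s + 1)), e2,
      ascPochhammer_eval_succ_left k (-(s + 1)), e2,
      ascPochhammer_eval_succ_left (k + 1) (s + 1 + 1), e4,
      ascPochhammer_eval_succ_left k (s + 1 + 1), e4,
      ascPochhammer_eval_succ_left (k + 1) (s + 1), ascPochhammer_eval_succ_left k (s + 1 + 1), e4]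
    simp only [ascPochhammer_succ_eval]
    push_cast at hk ⊢
    field_simp
    ring

theorem legendreP_eq_sum {m M : ℕ} (h : m ≤ M) (z : ℝ) :
    legendreP m z = ∑ k ∈ Finset.range (M + 1), legendreCoeff m k * ((1 - z) / 2) ^ k := by
  rw [legendreP, ordinaryHypergeometric_eq_tsum]
  refine (tsum_eq_sum (s := Finset.range (M + 1)) ?_).trans ?_
  · intro k hk
    have : m < k := by simp at hk; omega
    simp [ascPochhammer_eval_neg_coe_nat_of_lt this]
  · refine Finset.sum_congr rfl fun k _ => ?_
    have hf : (k.factorial : ℝ) ≠ 0 := by positivity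
    simp only [legendreCoeff, ascPochhammer_eval_one, smul_eq_mul]
    field_simp

theorem legendreP_recurrence (m : ℕ) (z : ℝ) :
    ((m : ℝ) + 2) * legendreP (m + 2) z =
      (2 * m + 3) * z * legendreP (m + 1) z - (m + 1) * legendreP m z := by
  rw [legendreP_eq_sum (le_refl (m + 2)), legendreP_eq_sum (show m ≤ m + 2 by omega),
    Finset.sum_range_succ', Finset.sum_range_succ' (fun k => legendreCoeff m k * _)]
  have h1 := legendreP_eq_sum (show m + 1 ≤ m + 2 by omega) z
  have h2 := legendreP_eq_sum (show m + 1 ≤ m + 1 by omega) z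
  rw [Finset.sum_range_succ'] at h1
  have hz : z = 1 - 2 * ((1 - z) / 2) := by ring
  set t := (1 - z) / 2
  have key : ∑ k ∈ Finset.range (m + 2), (((m : ℝ) + 2) * (legendreCoeff (m + 2 : ℕ) (k + 1) * t ^ (k + 1)))
      = ∑ k ∈ Finset.range (m + 2), ((2 * m + 3) * (legendreCoeff (m + 1 : ℕ) (k + 1) * t ^ (k + 1))
        - 2 * (2 * m + 3) * t * (legendreCoeff (m + 1 : ℕ) k * t ^ k)
        - (m + 1) * (legendreCoeff m (k + 1) * t ^ (k + 1))) := by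
    refine Finset.sum_congr rfl fun k _ => ?_
    push_cast
    linear_combination t ^ (k + 1) * legendreCoeff_recurrence m k
  simp only [Finset.sum_sub_distrib, ← Finset.mul_sum] at key
  rw [← h2] at key
  simp only [legendreCoeff_zero, pow_zero] at h1 ⊢
  rw [mul_add, key]
  linear_combination (-(2 * (m : ℝ) + 3)) * h1 - (2 * (m : ℝ) + 3) * legendreP (m + 1) z * hz

theorem homLegendre_eq_legendreP {a u v : ℝ} (h : u * v = a) (m : ℕ) :
    homLegendre a (v ^ 2) m = legendreP m u * v ^ m := by
  induction m using Nat.strong_induction_on with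
  | _ m ih =>
    match m with
    | 0 => simp [homLegendre, legendreP_eq_sum (le_refl 0), legendreCoeff_zero]
    | 1 =>
      simp [homLegendre, legendreP_eq_sum (le_refl 1), legendreCoeff, Finset.sum_range_succ]
      linear_combination -h
    | m + 2 =>
      have hm : (m : ℝ) + 2 ≠ 0 := by positivity
      rw [homLegendre, ih (m + 1) (by omega), ih m (by omega), div_eq_iff hm, ← h]
      linear_combination (-v ^ (m + 2)) * legendreP_recurrence m u

/-! ### The Legendre factor in x and y -/

/-- The argument of the Legendre polynomials times `(x - y) / (1 + x * y)`. -/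
noncomputable def wzA (x y : ℝ) : ℝ := (x + y) * (1 - x * y) / (1 + x * y) ^ 2

/-- The square of `(x - y) / (1 + x * y)`. -/
noncomputable def wzB (x y : ℝ) : ℝ := ((x - y) / (1 + x * y)) ^ 2

/-- The Legendre factor, extended to the diagonal. -/
noncomputable def wzQ (m : ℕ) (x y : ℝ) : ℝ := homLegendre (wzA x y) (wzB x y) m

theorem wzQ_recurrence (m : ℕ) (x y : ℝ) :
    ((m : ℝ) + 1) * wzQ (m + 1) x y =
      (2 * m + 1) * wzA x y * wzQ m x y - m * wzB x y * wzQ (m - 1) x y :=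
  homLegendre_recurrence _ _ m

theorem wzQ_comm (m : ℕ) (x y : ℝ) : wzQ m x y = wzQ m y x := by
  have hA : wzA x y = wzA y x := by simp only [wzA, mul_comm x y, add_comm x y]
  have hB : wzB x y = wzB y x := by
    simp only [wzB, mul_comm x y, div_pow]
    ring
  rw [wzQ, wzQ, hA, hB]

/-- Inversion fixes B and negates A; the sign disappears by parity at even index. -/
theorem wzQ_inv (n : ℕ) {x y : ℝ} (hx : 0 < x) (hy : 0 < y) :
    wzQ (2 * n) x⁻¹ y⁻¹ = wzQ (2 * n) x y := by
  have h : 1 + x * y ≠ 0 := by positivity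
  have hA : wzA x⁻¹ y⁻¹ = -wzA x y := by
    have h' : 1 + x⁻¹ * y⁻¹ ≠ 0 := by positivity
    have e : 1 + x⁻¹ * y⁻¹ = (1 + x * y) / (x * y) := by field_simp; ring
    simp only [wzA, e]
    field_simp
    ring
  have hB : wzB x⁻¹ y⁻¹ = wzB x y := by
    have e : 1 + x⁻¹ * y⁻¹ = (1 + x * y) / (x * y) := by field_simp; ring
    simp only [wzB, e]
    field_simp
    ring
  rw [wzQ, wzQ, hA, hB, homLegendre_neg]
  simp

theorem wzFactor_eq_wzQ (n : ℕ) {x y : ℝ} (hxy : x ≠ y) (h : 1 + x * y ≠ 0) :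
    wzFactor n x y = wzQ (2 * n) x y := by
  have h' : x - y ≠ 0 := sub_ne_zero.2 hxy
  rw [wzFactor, wzQ, wzB, ← homLegendre_eq_legendreP]
  rw [wzA]
  field_simp

/-- The homogenized form is polynomial in A and B, which are continuous across the diagonal, so its
value there is the required limit. -/
theorem isWZFactor_wzQ (n : ℕ) {x y : ℝ} (h : 1 + x * y ≠ 0) :
    IsWZFactor n x y (wzQ (2 * n) x y) := by
  refine ⟨fun hxy => (wzFactor_eq_wzQ n hxy h).symm, fun _ => ?_⟩
  have hA : ContinuousAt (fun q : ℝ × ℝ => wzA q.1 q.2) (x, y) := by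
    simp only [wzA]
    fun_prop (disch := exact pow_ne_zero 2 h)
  have hB : ContinuousAt (fun q : ℝ × ℝ => wzB q.1 q.2) (x, y) := by
    simp only [wzB]
    fun_prop (disch := exact h)
  have hQ : ContinuousAt (fun q : ℝ × ℝ => wzQ (2 * n) q.1 q.2) (x, y) :=
    (continuous_homLegendre (2 * n)).continuousAt.comp (hA.prodMk hB)
  refine (hQ.tendsto.mono_left nhdsWithin_le_nhds).congr' ?_
  have h1 : ∀ᶠ q : ℝ × ℝ in 𝓝 (x, y), 1 + q.1 * q.2 ≠ 0 :=
    ContinuousAt.eventually_ne (by fun_prop) h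
  filter_upwards [self_mem_nhdsWithin, nhdsWithin_le_nhds h1] with q hq hq1
  exact (wzFactor_eq_wzQ n hq hq1).symm

/-! ### Differential equation of the Legendre terms -/

theorem hasDerivAt_wzA {x y : ℝ} (h : 1 + x * y ≠ 0) :
    HasDerivAt (fun s => wzA s y)
      ((1 - 2 * x * y - y ^ 2) / (1 + x * y) ^ 2
        - 2 * y * ((x + y) * (1 - x * y)) / (1 + x * y) ^ 3) x := by
  have h1 : HasDerivAt (fun s : ℝ => 1 + s * y) y x := by
    simpa using ((hasDerivAt_id x).mul_const y).const_add 1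
  have h2 : HasDerivAt (fun s : ℝ => 1 - s * y) (-y) x := by
    simpa using ((hasDerivAt_id x).mul_const y).const_sub 1
  have h3 : HasDerivAt (fun s : ℝ => s + y) 1 x := (hasDerivAt_id x).add_const y
  refine ((h3.mul h2).div (h1.pow 2) (pow_ne_zero 2 h)).congr_deriv ?_
  simp only [Pi.mul_apply, Pi.pow_apply]
  push_cast
  field_simp
  ring

theorem hasDerivAt_wzB {x y : ℝ} (h : 1 + x * y ≠ 0) :
    HasDerivAt (fun s => wzB s y) (2 * (x - y) * (1 + y ^ 2) / (1 + x * y) ^ 3) x := by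
  have h1 : HasDerivAt (fun s : ℝ => 1 + s * y) y x := by
    simpa using ((hasDerivAt_id x).mul_const y).const_add 1
  have h3 : HasDerivAt (fun s : ℝ => s - y) 1 x := (hasDerivAt_id x).sub_const y
  refine ((h3.div h1 h).pow 2).congr_deriv ?_
  simp only [Pi.div_apply]
  push_cast
  field_simp
  ring

/-- The flux `x (1 - x ^ 2) ∂ₓ wzQ m x y`. -/
noncomputable def wzFlux (m : ℕ) (x y : ℝ) : ℝ :=
  m * ((1 - 3 * x ^ 2 - 3 * x * y + x ^ 3 * y) / (2 * (1 + x * y)) * wzQ m x y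
    + (1 + x ^ 2) * (x - y) / (2 * (1 + x * y)) * wzQ (m - 1) x y)

/-- With D = x(1 - x²)∂ₓ one has DA = αA + β and DB = 2αB + 2βA (`iA`, `iB`), which propagates
through the recurrence. The multiplied form remains valid at x = 1, where it forces the flux to
vanish. -/
theorem exists_hasDerivAt_wzQ (m : ℕ) {x y : ℝ} (h : 1 + x * y ≠ 0) :
    ∃ d, HasDerivAt (fun s => wzQ m s y) d x ∧ x * (1 - x ^ 2) * d = wzFlux m x y := by
  induction m using Nat.strong_induction_on with
  | _ m ih =>
    match m with
    | 0 => exact ⟨0, by simpa [wzQ, homLegendre] using hasDerivAt_const x (1 : ℝ), by simp [wzFlux]⟩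
    | 1 =>
      refine ⟨_, by simpa [wzQ, homLegendre] using hasDerivAt_wzA h, ?_⟩
      simp only [wzFlux, wzQ, Nat.sub_self, homLegendre, wzA]
      push_cast
      field_simp
      ring
    | m + 2 =>
      obtain ⟨d1, hd1, e1⟩ := ih (m + 1) (by omega)
      obtain ⟨d0, hd0, e0⟩ := ih m (by omega)
      have hA := hasDerivAt_wzA h
      have hB := hasDerivAt_wzB h
      have hm : (m : ℝ) + 2 ≠ 0 := by positivity
      refine ⟨_, (((hA.const_mul (2 * (m : ℝ) + 3)).mul hd1).sub
        ((hB.const_mul ((m : ℝ) + 1)).mul hd0)).div_const ((m : ℝ) + 2), ?_⟩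
      have r2 := wzQ_recurrence (m + 1) x y
      have r1 := wzQ_recurrence m x y
      have iA : x * (1 - x ^ 2) * ((1 - 2 * x * y - y ^ 2) / (1 + x * y) ^ 2
          - 2 * y * ((x + y) * (1 - x * y)) / (1 + x * y) ^ 3) =
          (1 - 3 * x ^ 2 - 3 * x * y + x ^ 3 * y) / (2 * (1 + x * y)) * wzA x y
            + (1 + x ^ 2) * (x - y) / (2 * (1 + x * y)) := by
        rw [wzA]
        field_simp
        ring
      have iB : x * (1 - x ^ 2) * (2 * (x - y) * (1 + y ^ 2) / (1 + x * y) ^ 3) =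
          2 * ((1 - 3 * x ^ 2 - 3 * x * y + x ^ 3 * y) / (2 * (1 + x * y))) * wzB x y
            + 2 * ((1 + x ^ 2) * (x - y) / (2 * (1 + x * y))) * wzA x y := by
        rw [wzA, wzB]
        field_simp
        ring
      simp only [wzFlux, Nat.add_sub_cancel, show m + 2 - 1 = m + 1 by omega] at e1 e0 r2 ⊢
      push_cast at e1 e0 r2 ⊢
      rw [mul_div_assoc', div_eq_iff hm]
      generalize (1 - 3 * x ^ 2 - 3 * x * y + x ^ 3 * y) / (2 * (1 + x * y)) = α at *
      generalize (1 + x ^ 2) * (x - y) / (2 * (1 + x * y)) = β at *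
      linear_combination (2 * m + 3) * wzA x y * e1 - (m + 1) * wzB x y * e0
        - (m + 1) * β * r1 - (m + 2) * α * r2 + (2 * m + 3) * wzQ (m + 1) x y * iA
        - (m + 1) * wzQ m x y * iB

theorem hasDerivAt_wzQ (m : ℕ) {x y : ℝ} (h : 1 + x * y ≠ 0) (hp : x * (1 - x ^ 2) ≠ 0) :
    HasDerivAt (fun s => wzQ m s y) (wzFlux m x y / (x * (1 - x ^ 2))) x := by
  obtain ⟨d, hd, e⟩ := exists_hasDerivAt_wzQ m h
  rwa [← e, mul_div_cancel_left₀ _ hp]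

/-- A Legendre term divided by `1 + x * y`. -/
noncomputable def wzTerm (m : ℕ) (x y : ℝ) : ℝ := wzQ m x y / (1 + x * y)

/-- The flux `x (1 - x ^ 2) ∂ₓ wzTerm m x y`. -/
noncomputable def wzTermFlux (m : ℕ) (x y : ℝ) : ℝ :=
  wzFlux m x y / (1 + x * y) - x * (1 - x ^ 2) * y * wzQ m x y / (1 + x * y) ^ 2

theorem exists_hasDerivAt_wzTerm (m : ℕ) {x y : ℝ} (h : 1 + x * y ≠ 0) :
    ∃ d, HasDerivAt (fun s => wzTerm m s y) d x ∧ x * (1 - x ^ 2) * d = wzTermFlux m x y := by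
  obtain ⟨d, hd, e⟩ := exists_hasDerivAt_wzQ m h
  have h1 : HasDerivAt (fun s : ℝ => 1 + s * y) y x := by
    simpa using ((hasDerivAt_id x).mul_const y).const_add 1
  refine ⟨_, hd.div h1 h, ?_⟩
  rw [wzTermFlux, ← e]
  field_simp

theorem hasDerivAt_wzTerm (m : ℕ) {x y : ℝ} (h : 1 + x * y ≠ 0) (hp : x * (1 - x ^ 2) ≠ 0) :
    HasDerivAt (fun s => wzTerm m s y) (wzTermFlux m x y / (x * (1 - x ^ 2))) x := by
  obtain ⟨d, hd, e⟩ := exists_hasDerivAt_wzTerm m h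
  rwa [← e, mul_div_cancel_left₀ _ hp]

theorem continuousAt_wzFlux (m : ℕ) {x y : ℝ} (h : 1 + x * y ≠ 0) :
    ContinuousAt (fun s => wzFlux m s y) x := by
  have hc (k : ℕ) : ContinuousAt (fun s => wzQ k s y) x :=
    let ⟨_, hd, _⟩ := exists_hasDerivAt_wzQ k h
    hd.continuousAt
  have h2 : 2 * (1 + x * y) ≠ 0 := mul_ne_zero two_ne_zero h
  have hm := hc m
  have hm1 := hc (m - 1)
  simp only [wzFlux]
  fun_prop (disch := exact h2)

theorem continuousAt_wzTermFlux (m : ℕ) {x y : ℝ} (h : 1 + x * y ≠ 0) :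
    ContinuousAt (fun s => wzTermFlux m s y) x := by
  obtain ⟨_, hd, _⟩ := exists_hasDerivAt_wzQ m h
  have hc := hd.continuousAt
  have hF := continuousAt_wzFlux m h
  have h2 := pow_ne_zero 2 h
  simp only [wzTermFlux]
  fun_prop (disch := assumption)

/-- The equation (pF')' = xF holds up to a difference in m, arranged to telescope over even m after
weighting by `wzCoeff`. -/
theorem hasDerivAt_wzTermFlux (m : ℕ) {x y : ℝ} (h : 1 + x * y ≠ 0) (hp : x * (1 - x ^ 2) ≠ 0) :
    HasDerivAt (fun s => wzTermFlux m s y)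
      (x * wzTerm m x y + ((m : ℝ) ^ 2 * wzQ (m - 1) x y
        - ((m : ℝ) + 1) ^ 2 * wzQ (m + 1) x y) / (1 + x * y)) x := by
  have hx : HasDerivAt (fun s : ℝ => s) 1 x := hasDerivAt_id x
  have hJ : HasDerivAt (fun s : ℝ => 1 + s * y) y x := by
    simpa using (hx.mul_const y).const_add 1
  have hJ2 : HasDerivAt (fun s : ℝ => 2 * (1 + s * y)) (2 * y) x := hJ.const_mul 2
  have h2 : 2 * (1 + x * y) ≠ 0 := mul_ne_zero two_ne_zero h
  have hα : HasDerivAt (fun s : ℝ => 1 - 3 * s ^ 2 - 3 * s * y + s ^ 3 * y)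
      (-6 * x - 3 * y + 3 * x ^ 2 * y) x := by
    refine (((((hx.pow 2).const_mul 3).const_sub 1).sub ((hx.const_mul 3).mul_const y)).add
      ((hx.pow 3).mul_const y)).congr_deriv ?_
    push_cast
    ring
  have hβ : HasDerivAt (fun s : ℝ => (1 + s ^ 2) * (s - y)) (2 * x * (x - y) + (1 + x ^ 2)) x := by
    refine (((hx.pow 2).const_add 1).mul (hx.sub_const y)).congr_deriv ?_
    push_cast
    simp
  have hpd : HasDerivAt (fun s : ℝ => s * (1 - s ^ 2) * y) ((1 - 3 * x ^ 2) * y) x := by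
    refine ((hx.mul ((hx.pow 2).const_sub 1)).mul_const y).congr_deriv ?_
    simp only [Pi.pow_apply]
    push_cast
    ring
  have hF := (((hα.div hJ2 h2).mul (hasDerivAt_wzQ m h hp)).add
    ((hβ.div hJ2 h2).mul (hasDerivAt_wzQ (m - 1) h hp))).const_mul (m : ℝ)
  have hT := (hF.div hJ h).sub ((hpd.mul (hasDerivAt_wzQ m h hp)).div (hJ.pow 2) (pow_ne_zero 2 h))
  refine hT.congr_deriv ?_
  simp only [Pi.mul_apply, Pi.pow_apply, Pi.add_apply, Pi.div_apply]
  have hx0 : x ≠ 0 := left_ne_zero_of_mul hp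
  have hx1 : 1 - x ^ 2 ≠ 0 := right_ne_zero_of_mul hp
  cases m with
  | zero =>
    simp only [wzFlux, wzTerm, wzQ, homLegendre, wzA]
    push_cast
    field_simp
    ring
  | succ m =>
    have r2 := wzQ_recurrence (m + 1) x y
    have r1 := wzQ_recurrence m x y
    simp only [wzFlux, wzTerm, Nat.add_sub_cancel, wzA, wzB] at r1 r2 ⊢
    push_cast at r1 r2 ⊢
    generalize wzQ (m + 1 + 1) x y = q2 at *
    generalize wzQ (m + 1) x y = q1 at *
    generalize wzQ m x y = q0 at *
    generalize wzQ (m - 1) x y = q3 at *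
    generalize (m : ℝ) = k at *
    -- `r1` eliminates `q3`, which enters through the flux of the lower neighbour; `r2` eliminates
    -- `q2`.
    linear_combination (norm := skip)
      (k + 1) * (1 + x ^ 2) ^ 2 / (4 * (x * (1 - x ^ 2)) * (1 + x * y)) * r1
        + (k + 2) / (1 + x * y) * r2
    field_simp
    ring

/-! ### Wronskian comparison at a singular point -/

theorem abs_sub_le_of_hasDerivAt_of_ne {f f' : ℝ → ℝ} {a x C : ℝ}
    (hc : ContinuousOn f (Set.uIcc a x))
    (hd : ∀ z ∈ Set.uIcc a x, z ≠ a → HasDerivAt f (f' z) z)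
    (hb : ∀ z ∈ Set.uIcc a x, z ≠ a → |f' z| ≤ C) : |f x - f a| ≤ C * |x - a| := by
  rcases lt_trichotomy a x with h | h | h
  · rw [Set.uIcc_of_le h.le] at hc hd hb
    obtain ⟨c, hcm, e⟩ := exists_hasDerivAt_eq_slope f f' h hc
      fun z hz => hd z (Set.Ioo_subset_Icc_self hz) hz.1.ne'
    have h0 : x - a ≠ 0 := sub_ne_zero.2 h.ne'
    rw [eq_div_iff h0] at e
    rw [← e, abs_mul]
    exact mul_le_mul_of_nonneg_right (hb c (Set.Ioo_subset_Icc_self hcm) hcm.1.ne') (abs_nonneg _)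
  · simp [h]
  · rw [Set.uIcc_of_ge h.le] at hc hd hb
    obtain ⟨c, hcm, e⟩ := exists_hasDerivAt_eq_slope f f' h hc
      fun z hz => hd z (Set.Ioo_subset_Icc_self hz) hz.2.ne
    have h0 : a - x ≠ 0 := sub_ne_zero.2 h.ne'
    rw [eq_div_iff h0] at e
    rw [abs_sub_comm (f x), abs_sub_comm x, ← e, abs_mul]
    exact mul_le_mul_of_nonneg_right (hb c (Set.Ioo_subset_Icc_self hcm) hcm.2.ne) (abs_nonneg _)

/-- Two approximate solutions of `(p F')' = q F`, regular at a simple zero `a` of `p`, are nearly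
proportional. Here `PH` and `PG` are the fluxes `p H'` and `p G'`. -/
theorem abs_div_sub_div_le_of_approx_solutions {p q H G PH PG eH eG : ℝ → ℝ} {a x c g e : ℝ}
    (hc0 : 0 < c) (hg0 : 0 < g)
    (hp : ∀ z ∈ Set.uIcc a x, c * |z - a| ≤ |p z|)
    (cH : ContinuousOn H (Set.uIcc a x)) (cG : ContinuousOn G (Set.uIcc a x))
    (cPH : ContinuousOn PH (Set.uIcc a x)) (cPG : ContinuousOn PG (Set.uIcc a x))
    (hH : ∀ z ∈ Set.uIcc a x, z ≠ a → HasDerivAt H (PH z / p z) z)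
    (hG : ∀ z ∈ Set.uIcc a x, z ≠ a → HasDerivAt G (PG z / p z) z)
    (hPH : ∀ z ∈ Set.uIcc a x, z ≠ a → HasDerivAt PH (q z * H z + eH z) z)
    (hPG : ∀ z ∈ Set.uIcc a x, z ≠ a → HasDerivAt PG (q z * G z + eG z) z)
    (hPHa : PH a = 0) (hPGa : PG a = 0)
    (hg : ∀ z ∈ Set.uIcc a x, g ≤ G z)
    (he : ∀ z ∈ Set.uIcc a x, |eH z * G z - H z * eG z| ≤ e) :
    |H x / G x - H a / G a| ≤ e / (c * g ^ 2) * |x - a| := by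
  -- In the derivative of the Wronskian the q-terms and the products PH·PG/p cancel, leaving only
  -- the errors; it vanishes at `a`.
  have hW (z : ℝ) (hz : z ∈ Set.uIcc a x) : |PH z * G z - H z * PG z| ≤ e * |z - a| := by
    have hs : Set.uIcc a z ⊆ Set.uIcc a x := Set.uIcc_subset_uIcc_left hz
    have := abs_sub_le_of_hasDerivAt_of_ne (f := fun z => PH z * G z - H z * PG z)
      (f' := fun z => eH z * G z - H z * eG z) (a := a) (x := z) (C := e)
      (((cPH.mul cG).sub (cH.mul cPG)).mono hs) (fun w hw hwa => by
        refine (((hPH w (hs hw) hwa).mul (hG w (hs hw) hwa)).sub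
          ((hH w (hs hw) hwa).mul (hPG w (hs hw) hwa))).congr_deriv ?_
        ring) (fun w hw _ => he w (hs hw))
    simpa [hPHa, hPGa] using this
  have hG0 (z : ℝ) (hz : z ∈ Set.uIcc a x) : G z ≠ 0 := (hg0.trans_le (hg z hz)).ne'
  -- (H/G)' is the Wronskian over pG²; the factor |z - a| gained above cancels the zero of p.
  refine abs_sub_le_of_hasDerivAt_of_ne (f := fun z => H z / G z)
    (f' := fun z => (PH z * G z - H z * PG z) / (p z * G z ^ 2)) (cH.div cG hG0) ?_ ?_
  · intro z hz hza
    have hpz : p z ≠ 0 := by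
      have := (mul_pos hc0 (abs_pos.2 (sub_ne_zero.2 hza))).trans_le (hp z hz)
      exact abs_pos.1 this
    have hGz := hG0 z hz
    refine ((hH z hz hza).div (hG z hz hza) hGz).congr_deriv ?_
    field_simp
  · intro z hz hza
    have hd : 0 < |z - a| := abs_pos.2 (sub_ne_zero.2 hza)
    have he0 : 0 ≤ e := (abs_nonneg _).trans (he z hz)
    rw [abs_div, abs_mul, abs_pow]
    calc _ ≤ e * |z - a| / (c * |z - a| * g ^ 2) := by
          gcongr
          · exact hW z hz
          · exact hp z hz
          · exact (hg z hz).trans (le_abs_self _)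
      _ = e / (c * g ^ 2) := by field_simp

/-! ### Coefficients, telescoping and geometric bounds -/

theorem wzCoeff_zero : wzCoeff 0 = 1 := by simp [wzCoeff]

theorem wzCoeff_nonneg (n : ℕ) : 0 ≤ wzCoeff n := by
  rw [wzCoeff]
  positivity

theorem wzCoeff_succ (n : ℕ) :
    wzCoeff (n + 1) * (2 * ((n + 1 : ℕ) : ℝ)) ^ 2 = wzCoeff n * (2 * n + 1) ^ 2 := by
  have hf : (n.factorial : ℝ) ≠ 0 := by positivity
  have hn : (n : ℝ) + 1 ≠ 0 := by positivity
  simp only [wzCoeff, ascPochhammer_succ_eval, Nat.factorial_succ]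
  push_cast
  field_simp
  ring

theorem wzCoeff_le_one (n : ℕ) : wzCoeff n ≤ 1 := by
  induction n with
  | zero => rw [wzCoeff_zero]
  | succ n ih =>
    have h := wzCoeff_succ n
    have h0 : (0 : ℝ) < (2 * ((n + 1 : ℕ) : ℝ)) ^ 2 := by positivity
    have h1 : (2 * (n : ℝ) + 1) ^ 2 ≤ (2 * ((n + 1 : ℕ) : ℝ)) ^ 2 := by
      push_cast
      gcongr
      linarith
    refine le_of_mul_le_mul_right ?_ h0
    rw [h]
    exact mul_le_mul ih h1 (by positivity) zero_le_one

/-- By `wzCoeff_succ` consecutive terms cancel; the lower boundary term carries the factor (2·0)².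
-/
theorem sum_wzCoeff_telescope (c : ℕ → ℝ) (N : ℕ) :
    ∑ n ∈ Finset.range (N + 1), wzCoeff n * ((2 * (n : ℝ)) ^ 2 * c n - (2 * n + 1) ^ 2 * c (n + 1))
      = -(wzCoeff N * (2 * N + 1) ^ 2 * c (N + 1)) := by
  induction N with
  | zero => simp
  | succ N ih =>
    rw [Finset.sum_range_succ, ih]
    linear_combination c (N + 1) * wzCoeff_succ N

theorem abs_wzCoeff_mul_le {f : ℕ → ℝ} {n : ℕ} (hf : |f n| ≤ (1 / 4) ^ n) :
    |wzCoeff n * f n| ≤ (1 / 4) ^ n := by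
  rw [abs_mul, abs_of_nonneg (wzCoeff_nonneg n)]
  exact (mul_le_of_le_one_left (abs_nonneg _) (wzCoeff_le_one n)).trans hf

theorem summable_wzCoeff_mul {f : ℕ → ℝ} (hf : ∀ n, |f n| ≤ (1 / 4) ^ n) :
    Summable fun n => wzCoeff n * f n :=
  Summable.of_norm_bounded (summable_geometric_of_lt_one (by norm_num) (by norm_num))
    fun n => abs_wzCoeff_mul_le (hf n)

theorem abs_sum_wzCoeff_mul_sub_le {f : ℕ → ℝ} (hf : ∀ n, |f n| ≤ (1 / 4) ^ n) (N : ℕ) :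
    |∑ n ∈ Finset.range (N + 1), wzCoeff n * f n - f 0| ≤ 1 / 3 := by
  rw [Finset.sum_range_succ', wzCoeff_zero, one_mul, add_sub_cancel_right]
  refine (Finset.abs_sum_le_sum_abs _ _).trans
    ((Finset.sum_le_sum fun n _ => abs_wzCoeff_mul_le (hf (n + 1))).trans ?_)
  have h (N : ℕ) : ∑ n ∈ Finset.range N, (1 / 4 : ℝ) ^ (n + 1) = 1 / 3 - 1 / 3 * (1 / 4) ^ N := by
    induction N with
    | zero => simp
    | succ N ih => rw [Finset.sum_range_succ, ih]; ring
  rw [h]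
  have : (0 : ℝ) ≤ 1 / 3 * (1 / 4) ^ N := by positivity
  linarith

theorem abs_sum_wzCoeff_mul_le {f : ℕ → ℝ} (hf : ∀ n, |f n| ≤ (1 / 4) ^ n) (N : ℕ) :
    |∑ n ∈ Finset.range (N + 1), wzCoeff n * f n| ≤ 2 := by
  have h1 := abs_le.1 (abs_sum_wzCoeff_mul_sub_le hf N)
  have h2 := abs_le.1 (hf 0)
  rw [abs_le]
  constructor <;> linarith [h1.1, h1.2, h2.1, h2.2, pow_zero (1 / 4 : ℝ)]

theorem hasDerivAt_sum_wzCoeff_mul {F : ℕ → ℝ → ℝ} {F' : ℕ → ℝ} {x : ℝ} (N : ℕ)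
    (h : ∀ n, HasDerivAt (F n) (F' n) x) :
    HasDerivAt (fun s => ∑ n ∈ Finset.range N, wzCoeff n * F n s)
      (∑ n ∈ Finset.range N, wzCoeff n * F' n) x :=
  HasDerivAt.fun_sum fun n _ => (h n).const_mul (wzCoeff n)

theorem tendsto_sq_mul_geometric :
    Tendsto (fun N : ℕ => (2 * (N : ℝ) + 1) ^ 2 * (1 / 4 : ℝ) ^ N) atTop (𝓝 0) := by
  have h (k : ℕ) := tendsto_pow_const_mul_const_pow_of_abs_lt_one k
    (show |(1 / 4 : ℝ)| < 1 by rw [abs_lt]; norm_num)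
  have := (((h 2).const_mul 4).add ((h 1).const_mul 4)).add (h 0)
  simp only [mul_zero, add_zero] at this
  refine this.congr fun N => ?_
  ring

/-! ### The elliptic series and bounds near 1 -/

theorem hasDerivAt_one_sub_sq_pow (n : ℕ) {x : ℝ} (hp : x * (1 - x ^ 2) ≠ 0) :
    HasDerivAt (fun s : ℝ => (1 - s ^ 2) ^ n)
      (-2 * n * x ^ 2 * (1 - x ^ 2) ^ n / (x * (1 - x ^ 2))) x := by
  have h1 : HasDerivAt (fun s : ℝ => 1 - s ^ 2) (-(2 * x)) x := by
    simpa using ((hasDerivAt_id x).pow 2).const_sub 1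
  refine (h1.pow n).congr_deriv ?_
  have hx0 : x ≠ 0 := left_ne_zero_of_mul hp
  have hx1 : 1 - x ^ 2 ≠ 0 := right_ne_zero_of_mul hp
  cases n with
  | zero => simp
  | succ n =>
    rw [Nat.add_sub_cancel, pow_succ _ n]
    field_simp

/-- The remainder has the same shape as for the Legendre terms, so the same telescoping applies. -/
theorem hasDerivAt_one_sub_sq_pow_flux (n : ℕ) (x : ℝ) :
    HasDerivAt (fun s : ℝ => -2 * n * s ^ 2 * (1 - s ^ 2) ^ n)
      (x * (1 - x ^ 2) ^ n + x * ((2 * (n : ℝ)) ^ 2 * (1 - x ^ 2) ^ (n - 1)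
        - (2 * n + 1) ^ 2 * (1 - x ^ 2) ^ n)) x := by
  have h1 : HasDerivAt (fun s : ℝ => 1 - s ^ 2) (-(2 * x)) x := by
    simpa using ((hasDerivAt_id x).pow 2).const_sub 1
  have h2 : HasDerivAt (fun s : ℝ => s ^ 2) (2 * x) x := by
    simpa using hasDerivAt_pow 2 x
  refine ((h2.const_mul (-2 * (n : ℝ))).mul (h1.pow n)).congr_deriv ?_
  simp only [Pi.pow_apply]
  cases n with
  | zero => simp
  | succ n =>
    rw [Nat.add_sub_cancel, pow_succ _ n]
    ring

/-- The sum of `wzCoeff n * t ^ n` at `t = 1 - x ^ 2`. -/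
noncomputable def ellipticSeries (x : ℝ) : ℝ := ∑' n, wzCoeff n * (1 - x ^ 2) ^ n

theorem ellipticSeries_one : ellipticSeries 1 = 1 := by
  rw [ellipticSeries, tsum_eq_single 0 (fun n hn => by simp [hn])]
  simp [wzCoeff_zero]

/-- The Legendre series divided by `1 + x * y`. -/
noncomputable def wzSum (x y : ℝ) : ℝ := ∑' n, wzCoeff n * wzTerm (2 * n) x y

section Bounds

variable {x y : ℝ}

theorem abs_one_sub_sq_pow_le (hx : x ∈ Set.Icc (9 / 10 : ℝ) (10 / 9)) (n : ℕ) :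
    |(1 - x ^ 2) ^ n| ≤ (1 / 4) ^ n := by
  rw [abs_pow]
  refine pow_le_pow_left₀ (abs_nonneg _) (abs_le.2 ⟨?_, ?_⟩) n <;> nlinarith [hx.1, hx.2]

theorem one_le_one_add_mul (hx : x ∈ Set.Icc (9 / 10 : ℝ) (10 / 9))
    (hy : y ∈ Set.Icc (9 / 10 : ℝ) (10 / 9)) : 1 ≤ 1 + x * y := by
  nlinarith [hx.1, hy.1]

theorem abs_wzQ_le (hx : x ∈ Set.Icc (9 / 10 : ℝ) (10 / 9))
    (hy : y ∈ Set.Icc (9 / 10 : ℝ) (10 / 9)) (m : ℕ) : |wzQ m x y| ≤ (1 / 2) ^ m := by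
  obtain ⟨hx1, hx2⟩ := hx
  obtain ⟨hy1, hy2⟩ := hy
  have ht1 : 81 / 100 ≤ x * y := by nlinarith
  have ht2 : x * y ≤ 100 / 81 := by nlinarith
  have hJ : 3 ≤ (1 + x * y) ^ 2 := by nlinarith
  have hJ0 : 0 < (1 + x * y) ^ 2 := by linarith
  have hA : |wzA x y| ≤ 18 / 100 := by
    rw [wzA, abs_div, abs_of_pos hJ0, div_le_iff₀ hJ0, abs_mul, abs_of_pos (by linarith : 0 < x + y)]
    have h1 : |1 - x * y| ≤ 24 / 100 := abs_le.2 ⟨by linarith, by linarith⟩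
    calc (x + y) * |1 - x * y| ≤ (20 / 9) * (24 / 100) := by
          gcongr
          linarith
      _ ≤ 18 / 100 * 3 := by norm_num
      _ ≤ _ := by gcongr
  have hB : |wzB x y| ≤ 5 / 100 := by
    rw [wzB, abs_of_nonneg (sq_nonneg _), div_pow, div_le_iff₀ hJ0]
    have h1 : |x - y| ≤ 22 / 100 := abs_le.2 ⟨by linarith, by linarith⟩
    have h2 : (x - y) ^ 2 ≤ (22 / 100) ^ 2 := by
      rw [← sq_abs]
      gcongr
    linarith
  -- With r = 1/2: 2·0.18·(1/2) + 0.05 = 0.23 ≤ 1/4.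
  refine abs_homLegendre_le (by norm_num) (by linarith) ?_ m
  linarith

theorem abs_wzTerm_le (hx : x ∈ Set.Icc (9 / 10 : ℝ) (10 / 9))
    (hy : y ∈ Set.Icc (9 / 10 : ℝ) (10 / 9)) (n : ℕ) : |wzTerm (2 * n) x y| ≤ (1 / 4) ^ n := by
  have h := one_le_one_add_mul hx hy
  rw [wzTerm, abs_div, abs_of_pos (by linarith : 0 < 1 + x * y)]
  refine (div_le_self (abs_nonneg _) h).trans ((abs_wzQ_le hx hy _).trans ?_)
  rw [pow_mul]
  norm_num

end Bounds

/-! ### Factorization of the Legendre series -/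

theorem wzSum_eq_mul {x y : ℝ} (hx : x ∈ Set.Icc (9 / 10 : ℝ) (10 / 9))
    (hy : y ∈ Set.Icc (9 / 10 : ℝ) (10 / 9)) :
    wzSum x y = ellipticSeries x * wzSum 1 y := by
  have h1U : (1 : ℝ) ∈ Set.Icc (9 / 10 : ℝ) (10 / 9) := by norm_num
  have hU (z : ℝ) (hz : z ∈ Set.uIcc 1 x) : z ∈ Set.Icc (9 / 10 : ℝ) (10 / 9) :=
    Set.uIcc_subset_Icc h1U hx hz
  have hJ (z : ℝ) (hz : z ∈ Set.uIcc 1 x) : 1 + z * y ≠ 0 :=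
    (zero_lt_one.trans_le (one_le_one_add_mul (hU z hz) hy)).ne'
  have hpb (z : ℝ) (hz : z ∈ Set.uIcc 1 x) : 1 * |z - 1| ≤ |z * (1 - z ^ 2)| := by
    have h := hU z hz
    have e : z * (1 - z ^ 2) = -((z * (1 + z)) * (z - 1)) := by ring
    have hb : 1 ≤ z * (1 + z) := by nlinarith [h.1]
    rw [e, abs_neg, abs_mul, abs_of_pos (by linarith : 0 < z * (1 + z))]
    gcongr
  have hp0 (z : ℝ) (hz : z ∈ Set.uIcc 1 x) (hz1 : z ≠ 1) : z * (1 - z ^ 2) ≠ 0 := by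
    have h0 : 0 < |z - 1| := abs_pos.2 (sub_ne_zero.2 hz1)
    exact abs_pos.1 (h0.trans_le (by simpa using hpb z hz))
  set H : ℕ → ℝ → ℝ := fun N s => ∑ n ∈ Finset.range (N + 1), wzCoeff n * wzTerm (2 * n) s y with hHd
  set G : ℕ → ℝ → ℝ := fun N s => ∑ n ∈ Finset.range (N + 1), wzCoeff n * (1 - s ^ 2) ^ n with hGd
  have hGlow (N : ℕ) (z : ℝ) (hz : z ∈ Set.Icc (9 / 10 : ℝ) (10 / 9)) : 1 / 2 ≤ G N z := by
    have := (abs_le.1 (abs_sum_wzCoeff_mul_sub_le (abs_one_sub_sq_pow_le hz) N)).1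
    rw [pow_zero] at this
    simp only [hGd]
    linarith
  -- The 6 is 1·2 + 2·2, from the bounds on `eH`, `G`, `H`, `eG`; the denominator uses c = 1, g =
  -- 1/2.
  have key (N : ℕ) : |H N x / G N x - H N 1 / G N 1| ≤
      (6 * ((2 * (N : ℝ) + 1) ^ 2 * (1 / 4) ^ N)) / (1 * (1 / 2) ^ 2) * |x - 1| := by
    refine abs_div_sub_div_le_of_approx_solutions (p := fun z => z * (1 - z ^ 2)) (q := fun z => z)
      (H := H N) (G := G N)
      (PH := fun s => ∑ n ∈ Finset.range (N + 1), wzCoeff n * wzTermFlux (2 * n) s y)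
      (PG := fun s => ∑ n ∈ Finset.range (N + 1),
        wzCoeff n * (-2 * n * s ^ 2 * (1 - s ^ 2) ^ n))
      (eH := fun s => -(wzCoeff N * (2 * N + 1) ^ 2 * (wzQ (2 * N + 1) s y / (1 + s * y))))
      (eG := fun s => -(wzCoeff N * (2 * N + 1) ^ 2 * (s * (1 - s ^ 2) ^ N)))
      one_pos (by norm_num) hpb ?_ ?_ ?_ ?_ ?_ ?_ ?_ ?_ ?_ ?_ (fun z hz => hGlow N z (hU z hz)) ?_
    · refine continuousOn_finsetSum _ fun n _ => continuousOn_const.mul fun z hz => ?_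
      obtain ⟨_, hd, _⟩ := exists_hasDerivAt_wzTerm (2 * n) (hJ z hz)
      exact hd.continuousAt.continuousWithinAt
    · simp only [hGd]
      fun_prop
    · exact continuousOn_finsetSum _ fun n _ => continuousOn_const.mul fun z hz =>
        (continuousAt_wzTermFlux (2 * n) (hJ z hz)).continuousWithinAt
    · fun_prop
    · intro z hz hz1
      refine (hasDerivAt_sum_wzCoeff_mul (N + 1) fun n =>
        hasDerivAt_wzTerm (2 * n) (hJ z hz) (hp0 z hz hz1)).congr_deriv ?_
      rw [Finset.sum_div]
      exact Finset.sum_congr rfl fun n _ => mul_div_assoc' _ _ _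
    · intro z hz hz1
      refine (hasDerivAt_sum_wzCoeff_mul (N + 1) fun n =>
        hasDerivAt_one_sub_sq_pow n (hp0 z hz hz1)).congr_deriv ?_
      rw [Finset.sum_div]
      exact Finset.sum_congr rfl fun n _ => mul_div_assoc' _ _ _
    · intro z hz hz1
      refine (hasDerivAt_sum_wzCoeff_mul (N + 1) fun n =>
        hasDerivAt_wzTermFlux (2 * n) (hJ z hz) (hp0 z hz hz1)).congr_deriv ?_
      -- At n = 0 the truncated index 2n - 1 is harmless, since its coefficient is 0.
      have ht := sum_wzCoeff_telescope (fun n => wzQ (2 * n - 1) z y / (1 + z * y)) N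
      simp only [show 2 * (N + 1) - 1 = 2 * N + 1 by omega] at ht
      rw [← ht]
      simp only [hHd]
      rw [Finset.mul_sum, ← Finset.sum_add_distrib]
      refine Finset.sum_congr rfl fun n _ => ?_
      rw [show 2 * (n + 1) - 1 = 2 * n + 1 by omega]
      push_cast
      ring
    · intro z _ _
      refine (hasDerivAt_sum_wzCoeff_mul (N + 1) fun n =>
        hasDerivAt_one_sub_sq_pow_flux n z).congr_deriv ?_
      have ht := sum_wzCoeff_telescope (fun n => z * (1 - z ^ 2) ^ (n - 1)) N
      simp only [Nat.add_sub_cancel] at ht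
      rw [← ht]
      simp only [hGd]
      rw [Finset.mul_sum, ← Finset.sum_add_distrib]
      refine Finset.sum_congr rfl fun n _ => ?_
      ring
    · refine Finset.sum_eq_zero fun n _ => ?_
      obtain ⟨_, _, e⟩ := exists_hasDerivAt_wzTerm (2 * n) (hJ 1 Set.left_mem_uIcc)
      simp [← e]
    · refine Finset.sum_eq_zero fun n _ => ?_
      cases n <;> simp
    · intro z hz
      have hz' := hU z hz
      have hw := wzCoeff_le_one N
      have hw0 := wzCoeff_nonneg N
      have bG : |G N z| ≤ 2 := abs_sum_wzCoeff_mul_le (abs_one_sub_sq_pow_le hz') N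
      have bH : |H N z| ≤ 2 := abs_sum_wzCoeff_mul_le (abs_wzTerm_le hz' hy) N
      have hJ1 := one_le_one_add_mul hz' hy
      have b1 : |wzQ (2 * N + 1) z y / (1 + z * y)| ≤ (1 / 4) ^ N := by
        rw [abs_div, abs_of_pos (by linarith : 0 < 1 + z * y)]
        refine (div_le_self (abs_nonneg _) hJ1).trans ((abs_wzQ_le hz' hy _).trans ?_)
        rw [pow_succ, pow_mul, show (1 / 2 : ℝ) ^ 2 = 1 / 4 by norm_num]
        exact mul_le_of_le_one_right (by positivity) (by norm_num)
      have b2 : |z * (1 - z ^ 2) ^ N| ≤ 2 * (1 / 4) ^ N := by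
        rw [abs_mul, abs_of_pos (by linarith [hz'.1] : 0 < z)]
        exact mul_le_mul (by linarith [hz'.2]) (abs_one_sub_sq_pow_le hz' N) (abs_nonneg _)
          zero_le_two
      have hk : 0 ≤ (2 * (N : ℝ) + 1) ^ 2 := by positivity
      have aux (t : ℝ) : |-(wzCoeff N * (2 * N + 1) ^ 2 * t)| ≤ (2 * (N : ℝ) + 1) ^ 2 * |t| := by
        rw [abs_neg, abs_mul, abs_mul, abs_of_nonneg hw0, abs_of_nonneg hk]
        gcongr
        exact mul_le_of_le_one_left hk hw
      refine (abs_sub _ _).trans ?_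
      rw [abs_mul, abs_mul]
      calc _ ≤ ((2 * (N : ℝ) + 1) ^ 2 * (1 / 4) ^ N) * 2
            + 2 * ((2 * (N : ℝ) + 1) ^ 2 * (2 * (1 / 4) ^ N)) := by
            gcongr
            · exact (aux _).trans (mul_le_mul_of_nonneg_left b1 hk)
            · exact (aux _).trans (mul_le_mul_of_nonneg_left b2 hk)
        _ = _ := by ring
  have tH (z : ℝ) (hz : z ∈ Set.Icc (9 / 10 : ℝ) (10 / 9)) :
      Tendsto (fun N => H N z) atTop (𝓝 (wzSum z y)) :=
    (summable_wzCoeff_mul (abs_wzTerm_le hz hy)).hasSum.tendsto_sum_nat.comp (tendsto_add_atTop_nat 1)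
  have tG (z : ℝ) (hz : z ∈ Set.Icc (9 / 10 : ℝ) (10 / 9)) :
      Tendsto (fun N => G N z) atTop (𝓝 (ellipticSeries z)) :=
    (summable_wzCoeff_mul (abs_one_sub_sq_pow_le hz)).hasSum.tendsto_sum_nat.comp
      (tendsto_add_atTop_nat 1)
  have hG0 (z : ℝ) (hz : z ∈ Set.Icc (9 / 10 : ℝ) (10 / 9)) : ellipticSeries z ≠ 0 := by
    have : 1 / 2 ≤ ellipticSeries z := ge_of_tendsto' (tG z hz) fun N => hGlow N z hz
    linarith
  have hlim := ((((tH x hx).div (tG x hx) (hG0 x hx)).sub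
    ((tH 1 h1U).div (tG 1 h1U) (hG0 1 h1U))).abs)
  have he := (((tendsto_sq_mul_geometric.const_mul 6).div_const (1 * (1 / 2 : ℝ) ^ 2)).mul_const
    |x - 1|)
  have hle := le_of_tendsto_of_tendsto' hlim he key
  simp only [mul_zero, zero_div, zero_mul] at hle
  have heq := sub_eq_zero.1 (abs_nonpos_iff.1 hle)
  rw [ellipticSeries_one, div_one, div_eq_iff (hG0 x hx)] at heq
  rw [heq, mul_comm]

theorem wzSum_eq {x y : ℝ} (hx : x ∈ Set.Icc (9 / 10 : ℝ) (10 / 9))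
    (hy : y ∈ Set.Icc (9 / 10 : ℝ) (10 / 9)) :
    wzSum x y = ellipticSeries x * ellipticSeries y / 2 := by
  have h1U : (1 : ℝ) ∈ Set.Icc (9 / 10 : ℝ) (10 / 9) := by norm_num
  have hcomm : wzSum 1 y = wzSum y 1 := by
    simp only [wzSum, wzTerm, wzQ_comm _ 1 y, mul_comm 1 y]
  have h11 : wzSum 1 1 = 1 / 2 := by
    rw [wzSum, tsum_eq_single 0]
    · simp [wzTerm, wzQ, homLegendre, wzCoeff_zero]
      norm_num
    -- A and B both vanish at (1,1), so only n = 0 contributes.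
    · intro n hn
      obtain ⟨k, hk⟩ : ∃ k, 2 * n = k + 1 := ⟨2 * n - 1, by omega⟩
      simp [wzTerm, wzQ, wzA, wzB, hk, homLegendre_zero_zero]
  rw [wzSum_eq_mul hx hy, hcomm, wzSum_eq_mul hy h1U, h11]
  ring

theorem tsum_wzCoeff_mul_wzQ {x y : ℝ} (hx : x ∈ Set.Icc (9 / 10 : ℝ) (10 / 9))
    (hy : y ∈ Set.Icc (9 / 10 : ℝ) (10 / 9)) :
    ∑' n, wzCoeff n * wzQ (2 * n) x y = (1 + x * y) * (ellipticSeries x * ellipticSeries y / 2) := by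
  have h := (zero_lt_one.trans_le (one_le_one_add_mul hx hy)).ne'
  rw [← wzSum_eq hx hy, wzSum, ← tsum_mul_left]
  refine tsum_congr fun n => ?_
  rw [wzTerm]
  field_simp

theorem ellipticSeries_inv {x : ℝ} (hx : x ∈ Set.Icc (9 / 10 : ℝ) (10 / 9)) :
    ellipticSeries x⁻¹ = x * ellipticSeries x := by
  have h1U : (1 : ℝ) ∈ Set.Icc (9 / 10 : ℝ) (10 / 9) := by norm_num
  have hx0 : 0 < x := by linarith [hx.1]
  have hi : x⁻¹ ∈ Set.Icc (9 / 10 : ℝ) (10 / 9) := by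
    constructor
    · rw [le_inv_comm₀ (by norm_num) hx0]
      linarith [hx.2]
    · rw [inv_le_comm₀ hx0 (by norm_num)]
      linarith [hx.1]
  -- Equating the series at (1/x,1) and (x,1) gives (1 + 1/x) E(1/x) = (1 + x) E(x).
  have h := tsum_wzCoeff_mul_wzQ hi h1U
  rw [← tsum_congr fun n => congrArg (wzCoeff n * ·) (wzQ_inv n (inv_pos.2 hx0) one_pos), inv_inv,
    inv_one, tsum_wzCoeff_mul_wzQ hx h1U, ellipticSeries_one] at h
  have h1 : x + 1 ≠ 0 := by positivity
  field_simp at h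
  rw [one_div] at h
  refine mul_left_cancel₀ h1 ?_
  linear_combination -h

/-! ### Translation to elliptic integrals -/

theorem ellipticK_eq {k x : ℝ} (h : k ^ 2 = 1 - x ^ 2) :
    ellipticK k = Real.pi / 2 * ellipticSeries x := by
  rw [ellipticK, h, ellipticSeries, ordinaryHypergeometric_eq_tsum]
  congr 1
  refine tsum_congr fun n => ?_
  have hf : (n.factorial : ℝ) ≠ 0 := by positivity
  simp only [wzCoeff, ascPochhammer_eval_one, smul_eq_mul]
  field_simp

theorem ellipticK_sqrt_one_sub_sq {x : ℝ} (hx0 : 0 ≤ x) (hx : x ≤ 1) :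
    ellipticK (Real.sqrt (1 - x ^ 2)) = Real.pi / 2 * ellipticSeries x :=
  ellipticK_eq (Real.sq_sqrt (by nlinarith))

theorem ellipticK_sqrt_sq_sub_one_div {x : ℝ} (hx : 1 ≤ x) (hx' : x ≤ 10 / 9) :
    ellipticK (Real.sqrt (x ^ 2 - 1) / x) = Real.pi / 2 * (x * ellipticSeries x) := by
  rw [← ellipticSeries_inv ⟨by linarith, hx'⟩]
  refine ellipticK_eq ?_
  rw [div_pow, Real.sq_sqrt (by nlinarith)]
  field_simp

theorem wzSeriesEq_ellipticSeries {x y v : ℝ} (hx : x ∈ Set.Icc (9 / 10 : ℝ) (10 / 9))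
    (hy : y ∈ Set.Icc (9 / 10 : ℝ) (10 / 9))
    (hv : v = Real.pi ^ 2 / 4 * ((1 + x * y) * ellipticSeries x * ellipticSeries y)) :
    WZSeriesEq x y v := by
  have h := (zero_lt_one.trans_le (one_le_one_add_mul hx hy)).ne'
  refine ⟨fun n => wzQ (2 * n) x y, fun n => isWZFactor_wzQ n h,
    summable_wzCoeff_mul fun n => (abs_wzQ_le hx hy _).trans ?_, ?_⟩
  · rw [pow_mul]
    norm_num
  · rw [tsum_wzCoeff_mul_wzQ hx hy, hv]
    ring

theorem mainTheorem7 :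
    ∃ U ∈ 𝓝 (1 : ℝ), ∀ x ∈ U, ∀ y ∈ U,
      (x = 1 ∧ y = 1 → WZSeriesEq x y (Real.pi ^ 2 / 2)) ∧
      (1 ≤ x ∧ 1 ≤ y → WZSeriesEq x y
        ((1 + x * y) / (x * y) * ellipticK (Real.sqrt (x ^ 2 - 1) / x)
          * ellipticK (Real.sqrt (y ^ 2 - 1) / y))) ∧
      (1 ≤ x ∧ y ≤ 1 → WZSeriesEq x y
        ((1 + x * y) / x * ellipticK (Real.sqrt (x ^ 2 - 1) / x)
          * ellipticK (Real.sqrt (1 - y ^ 2)))) ∧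
      (x ≤ 1 ∧ 1 ≤ y → WZSeriesEq x y
        ((1 + x * y) / y * ellipticK (Real.sqrt (1 - x ^ 2))
          * ellipticK (Real.sqrt (y ^ 2 - 1) / y))) ∧
      (x ≤ 1 ∧ y ≤ 1 → WZSeriesEq x y
        ((1 + x * y) * ellipticK (Real.sqrt (1 - x ^ 2))
          * ellipticK (Real.sqrt (1 - y ^ 2)))) := by
  -- This interval is stable under x ↦ 1/x and small enough for the geometric bounds.
  refine ⟨Set.Icc (9 / 10) (10 / 9), Icc_mem_nhds (by norm_num) (by norm_num), fun x hx y hy => ?_⟩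
  have hx0 : 0 < x := by linarith [hx.1]
  have hy0 : 0 < y := by linarith [hy.1]
  refine ⟨?_, ?_, ?_, ?_, ?_⟩
  · rintro ⟨rfl, rfl⟩
    refine wzSeriesEq_ellipticSeries hx hx ?_
    rw [ellipticSeries_one]
    ring
  all_goals
    rintro ⟨h1, h2⟩
    refine wzSeriesEq_ellipticSeries hx hy ?_
  · rw [ellipticK_sqrt_sq_sub_one_div h1 hx.2, ellipticK_sqrt_sq_sub_one_div h2 hy.2]
    field_simp
    ring
  · rw [ellipticK_sqrt_sq_sub_one_div h1 hx.2, ellipticK_sqrt_one_sub_sq hy0.le h2]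
    field_simp
    ring
  · rw [ellipticK_sqrt_one_sub_sq hx0.le h1, ellipticK_sqrt_sq_sub_one_div h2 hy.2]
    field_simp
    ring
  · rw [ellipticK_sqrt_one_sub_sq hx0.le h1, ellipticK_sqrt_one_sub_sq hy0.le h2]
    ring
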